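/- Let $\varphi_0,\varphi_1,\varphi_2,\dots:\mathbb{R}\to\mathbb{C}$ be functions in $L^2(\mathbb{R})$. The following are equivalent. (i) There are numbers $b_n\in\mathbb{C}\setminus\{0\}$ and $c_n\in\mathbb{R}$ ($n\ge 0$) such that every $\varphi_n$ is differentiable on $\mathbb{R}$ and $$\varphi_0' = i c_0\varphi_0 + b_0\varphi_1,\qquad \varphi_n' = -\overline{b_{n-1}}\,\varphi_{n-1} + i c_n\varphi_n + b_n\varphi_{n+1}\quad (n\ge 1).$$ (ii) There are - a Borel probability measure $\mu$ on $\mathbb{R}$, all of whose moments are finite and which has infinitely many points of increase (that is, its support is infinite), - real polynomials $p_n$ with $\deg p_n=n$ ($n\ge 0$) and $\int p_m p_n\,d\mu=\delta_{mn}$ for all $m,n\ge0$, - a function $g\in L^2(\mathbb{R})$ that decays in the $L^2$ sense faster than any power, i.e. $\int_{|\xi|>R}|\xi^n g(\xi)|^2\,d\xi\to 0$ as $R\to\infty$ for every $n\ge 0$ (equivalently, $\xi^n g(\xi)\in L^2(\mathbb{R})$ for every $n\ge0$), and - numbers $\theta_n\in[0,2\pi)$ ($n\ge0$) such that for all $n\ge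 0$ and $x\in\mathbb{R}$ $$\varphi_n(x)=\frac{e^{i\theta_n}}{\sqrt{2\pi}}\int_{-\infty}^{\infty} e^{ix\xi}\,p_n(\xi)\,g(\xi)\,d\xi .$$ -/

import Mathlib

open MeasureTheory Filter Topology Polynomial ComplexConjugate

/-- The functions `φ n` are differentiable everywhere and satisfy the skew-Hermitian tridiagonal
differential recurrence with coefficients `b` and `c`:
`φ₀' = i c₀ φ₀ + b₀ φ₁` and `φₙ' = -conj bₙ₋₁ φₙ₋₁ + i cₙ φₙ + bₙ φₙ₊₁` for `n ≥ 1`. -/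
def SkewHermitianRecurrence (φ : ℕ → ℝ → ℂ) (b : ℕ → ℂ) (c : ℕ → ℝ) : Prop :=
  (∀ x : ℝ, HasDerivAt (φ 0) (Complex.I * (c 0 : ℂ) * φ 0 x + b 0 * φ 1 x) x) ∧
  ∀ (n : ℕ) (x : ℝ), HasDerivAt (φ (n + 1))
    (-conj (b n) * φ n x + Complex.I * (c (n + 1) : ℂ) * φ (n + 1) x
      + b (n + 1) * φ (n + 2) x) x

/-- All moments of `μ` are finite. -/
def HasFiniteMoments (μ : Measure ℝ) : Prop :=
  ∀ n : ℕ, Integrable (fun ξ : ℝ => ξ ^ n) μ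

/-- `p` is an orthonormal polynomial system for `μ`: `p n` is a real polynomial of degree exactly
`n`, and the `p n` are orthonormal in `L²(μ)`. -/
def IsOrthonormalPolynomialSystem (p : ℕ → ℝ[X]) (μ : Measure ℝ) : Prop :=
  (∀ n : ℕ, (p n).degree = n) ∧
  ∀ m n : ℕ, ∫ ξ, (p m).eval ξ * (p n).eval ξ ∂μ = if m = n then 1 else 0

/-- `g` decays in `L²` faster than any power: for every `n`, the `L²`-norm of `ξ ^ n * g ξ` over
`|ξ| > R` tends to `0` as `R → ∞`. -/
def RapidlyDecaying (g : ℝ → ℂ) : Prop :=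
  ∀ n : ℕ, Tendsto
    (fun R : ℝ => eLpNorm (fun ξ : ℝ => (ξ : ℂ) ^ n * g ξ) 2 (volume.restrict {ξ : ℝ | R < |ξ|}))
    atTop (𝓝 0)

/-! The Fourier transform turns d/dx into multiplication by iξ, up to scaling, so the differential
recurrence becomes, for almost every ξ, a scalar three-term recurrence.

From (i) to (ii): unimodular factors uₙ (`recurrencePhase`) absorb the arguments of the bₙ. What
remains is the real symmetric recurrence with off-diagonal |bₙ| and diagonal cₙ, so the transform of
φₙ is uₙ Pₙ times that of φ₀, with Pₙ the polynomials of this recurrence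
(`SkewHermitianRecurrence.fourier_ae_eq`). Hence g is a rescaled transform of φ₀, and it decays
rapidly because every Pₙ g is again in L². The measure μ depends on the Pₙ alone, not on g, and
comes from Favard's theorem (`exists_orthogonality_measure`): the spectral measures of the truncated
Jacobi matrices are tight, and their weak limit keeps all orthogonality relations.

From (ii) to (i): orthonormality gives a real three-term recurrence with nonzero off-diagonal
coefficients (`exists_three_term`). Rapid decay permits differentiation under the integral, which
multiplies pₙ by iξ, and the phases θₙ then turn the real coefficients into complex bₙ. -/

theorem HasFiniteMoments.integrable_eval {μ : Measure ℝ} (hμ : HasFiniteMoments μ) (q : ℝ[X]) :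
    Integrable (fun ξ : ℝ => q.eval ξ) μ := by
  simp only [Polynomial.eval_eq_sum_range]
  exact integrable_finsetSum _ fun i _ => (hμ i).const_mul _

/-- A polynomial of degree at most `N` is a linear combination of the first `N + 1` members of any
sequence of polynomials with `degree (p n) = n`. -/
theorem Polynomial.exists_eq_sum_of_degree_eq {p : ℕ → ℝ[X]} (hp : ∀ n : ℕ, (p n).degree = n) :
    ∀ (N : ℕ) (q : ℝ[X]), q.natDegree ≤ N →
      ∃ a : ℕ → ℝ, q = ∑ k ∈ Finset.range (N + 1), C (a k) * p k := by
  have hnat (n : ℕ) : (p n).natDegree = n := natDegree_eq_of_degree_eq_some (hp n)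
  have hlead (n : ℕ) : (p n).coeff n ≠ 0 := by
    have h : (p n).leadingCoeff ≠ 0 := leadingCoeff_ne_zero.2 fun h0 => by
      have := hp n
      simp [h0] at this
    rwa [leadingCoeff, hnat] at h
  intro N
  induction N with
  | zero =>
    intro q hq
    refine ⟨fun _ => q.coeff 0 / (p 0).coeff 0, ?_⟩
    have h0 := eq_C_of_natDegree_le_zero (hnat 0).le
    rw [Finset.sum_range_one, eq_C_of_natDegree_le_zero hq, h0, ← C_mul]
    simp [div_mul_cancel₀ _ (hlead 0)]
  | succ N ih =>
    intro q hq
    set t : ℝ := q.coeff (N + 1) / (p (N + 1)).coeff (N + 1) with ht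
    have hdeg : (q - C t * p (N + 1)).natDegree ≤ N := by
      rw [natDegree_le_iff_coeff_eq_zero]
      intro j hj
      rcases eq_or_lt_of_le (Nat.succ_le_of_lt hj) with h | h
      · subst h
        simp [ht, div_mul_cancel₀ _ (hlead (N + 1))]
      · rw [coeff_sub, coeff_C_mul, coeff_eq_zero_of_natDegree_lt (lt_of_le_of_lt hq h),
          coeff_eq_zero_of_natDegree_lt (by rw [hnat]; exact h)]
        simp
    obtain ⟨a, ha⟩ := ih _ hdeg
    refine ⟨fun k => if k = N + 1 then t else a k, ?_⟩
    rw [Finset.sum_range_succ]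
    simp only [if_true]
    have : ∑ k ∈ Finset.range (N + 1), C (if k = N + 1 then t else a k) * p k
        = ∑ k ∈ Finset.range (N + 1), C (a k) * p k := by
      refine Finset.sum_congr rfl fun k hk => ?_
      rw [if_neg (Finset.mem_range.1 hk).ne]
    rw [this, ← ha]
    ring

/-! ### Expansions and the three-term recurrence of orthonormal polynomials. -/

namespace IsOrthonormalPolynomialSystem

variable {p : ℕ → ℝ[X]} {μ : Measure ℝ}

theorem natDegree_eq (hp : IsOrthonormalPolynomialSystem p μ) (n : ℕ) : (p n).natDegree = n :=
  natDegree_eq_of_degree_eq_some (hp.1 n)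

theorem integral_sum_mul (hp : IsOrthonormalPolynomialSystem p μ) (hμ : HasFiniteMoments μ)
    (a : ℕ → ℝ) (N j : ℕ) :
    ∫ ξ, (∑ k ∈ Finset.range N, C (a k) * p k).eval ξ * (p j).eval ξ ∂μ =
      if j < N then a j else 0 := by
  have h (ξ : ℝ) : (∑ k ∈ Finset.range N, C (a k) * p k).eval ξ * (p j).eval ξ =
      ∑ k ∈ Finset.range N, a k * ((p k).eval ξ * (p j).eval ξ) := by
    simp [eval_finsetSum, Finset.sum_mul, mul_assoc]
  simp only [h]
  rw [integral_finsetSum]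
  · simp only [integral_const_mul, hp.2]
    simp
  · intro k _
    refine Integrable.const_mul ?_ _
    simpa using hμ.integrable_eval (p k * p j)

/-- The expansion of a polynomial in an orthonormal polynomial system. -/
theorem eq_sum_integral (hp : IsOrthonormalPolynomialSystem p μ) (hμ : HasFiniteMoments μ)
    {N : ℕ} {q : ℝ[X]} (hq : q.natDegree ≤ N) :
    q = ∑ k ∈ Finset.range (N + 1), C (∫ ξ, q.eval ξ * (p k).eval ξ ∂μ) * p k := by
  obtain ⟨a, ha⟩ := exists_eq_sum_of_degree_eq hp.1 N q hq
  conv_lhs => rw [ha]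
  refine Finset.sum_congr rfl fun k hk => ?_
  rw [ha, hp.integral_sum_mul hμ, if_pos (Finset.mem_range.1 hk)]

theorem integral_mul_eq_zero (hp : IsOrthonormalPolynomialSystem p μ) (hμ : HasFiniteMoments μ)
    {q : ℝ[X]} {j : ℕ} (hq : q.natDegree < j) : ∫ ξ, q.eval ξ * (p j).eval ξ ∂μ = 0 := by
  obtain ⟨a, ha⟩ := exists_eq_sum_of_degree_eq hp.1 _ q le_rfl
  rw [ha, hp.integral_sum_mul hμ, if_neg (by omega)]

/-- The three-term recurrence relation of an orthonormal polynomial system. -/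
theorem exists_three_term (hp : IsOrthonormalPolynomialSystem p μ) (hμ : HasFiniteMoments μ) :
    ∃ α β : ℕ → ℝ, (∀ n, β n ≠ 0) ∧ X * p 0 = C (β 0) * p 1 + C (α 0) * p 0 ∧
      ∀ n, X * p (n + 1) = C (β (n + 1)) * p (n + 2) + C (α (n + 1)) * p (n + 1)
        + C (β n) * p n := by
  have hdeg (n : ℕ) : (X * p n).natDegree = n + 1 := by
    have h0 : p n ≠ 0 := fun h => by
      have := hp.1 n
      simp [h] at this
    rw [natDegree_X_mul h0, hp.natDegree_eq]
  have hsymm (m n : ℕ) : ∫ ξ, (X * p m).eval ξ * (p n).eval ξ ∂μ =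
      ∫ ξ, (X * p n).eval ξ * (p m).eval ξ ∂μ := by
    refine integral_congr_ae (ae_of_all _ fun ξ => ?_)
    simp only [eval_mul, eval_X]
    ring
  have hexp (n : ℕ) : X * p (n + 1) =
      C (∫ ξ, (X * p (n + 1)).eval ξ * (p (n + 1 + 1)).eval ξ ∂μ) * p (n + 2)
      + C (∫ ξ, (X * p (n + 1)).eval ξ * (p (n + 1)).eval ξ ∂μ) * p (n + 1)
      + C (∫ ξ, (X * p n).eval ξ * (p (n + 1)).eval ξ ∂μ) * p n := by
    conv_lhs => rw [hp.eq_sum_integral hμ (hdeg (n + 1)).le]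
    rw [Finset.sum_range_succ, Finset.sum_range_succ, Finset.sum_range_succ,
      Finset.sum_eq_zero, hsymm n (n + 1)]
    · ring
    -- For k < n, moving X onto `p k` leaves degree k + 1 < n + 1, which is orthogonal to `p (n +
    -- 1)`.
    · intro k hk
      rw [hsymm, hp.integral_mul_eq_zero hμ]
      · simp
      · rw [hdeg]
        have := Finset.mem_range.1 hk
        omega
  have hexp0 : X * p 0 = C (∫ ξ, (X * p 0).eval ξ * (p (0 + 1)).eval ξ ∂μ) * p 1
      + C (∫ ξ, (X * p 0).eval ξ * (p 0).eval ξ ∂μ) * p 0 := by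
    conv_lhs => rw [hp.eq_sum_integral hμ (hdeg 0).le]
    rw [Finset.sum_range_succ, Finset.sum_range_succ, Finset.sum_range_zero]
    ring
  obtain ⟨α, hα⟩ : ∃ α : ℕ → ℝ, ∀ n, ∫ ξ, (X * p n).eval ξ * (p n).eval ξ ∂μ = α n :=
    ⟨_, fun _ => rfl⟩
  obtain ⟨β, hβ⟩ : ∃ β : ℕ → ℝ, ∀ n, ∫ ξ, (X * p n).eval ξ * (p (n + 1)).eval ξ ∂μ = β n :=
    ⟨_, fun _ => rfl⟩
  simp only [hα, hβ] at hexp hexp0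
  refine ⟨α, β, fun n h0 => ?_, hexp0, hexp⟩
  -- If β n vanished, X * p n would lie in the span of `p 0`, …, `p n`, against its degree n + 1.
  have hle : (X * p n).natDegree ≤ n := by
    rw [← hβ] at h0
    obtain ⟨a, ha⟩ := exists_eq_sum_of_degree_eq hp.1 (n + 1) _ (hdeg n).le
    have ha0 : a (n + 1) = 0 := by
      rw [← h0, ha, hp.integral_sum_mul hμ, if_pos (by omega)]
    rw [ha, Finset.sum_range_succ, ha0, C_0, zero_mul, add_zero]
    refine natDegree_sum_le_of_forall_le _ _ fun k hk => (natDegree_C_mul_le _ _).trans ?_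
    rw [hp.natDegree_eq]
    exact Nat.lt_succ_iff.1 (Finset.mem_range.1 hk)
  rw [hdeg] at hle
  omega

end IsOrthonormalPolynomialSystem

/-! ### Jacobi polynomials and truncated Jacobi matrices. -/

/-- The polynomials with `p₀ = 1` and three-term recurrence
`X pₙ = βₙ pₙ₊₁ + cₙ pₙ + βₙ₋₁ pₙ₋₁`. -/
noncomputable def jacobiPolynomial (β c : ℕ → ℝ) : ℕ → ℝ[X]
  | 0 => 1
  | 1 => C (β 0)⁻¹ * (X - C (c 0))
  | n + 2 => C (β (n + 1))⁻¹ *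
      ((X - C (c (n + 1))) * jacobiPolynomial β c (n + 1) - C (β n) * jacobiPolynomial β c n)

section JacobiPolynomial

variable {β c : ℕ → ℝ}

theorem jacobiPolynomial_zero : jacobiPolynomial β c 0 = 1 := by
  rw [jacobiPolynomial]

theorem mul_eval_jacobiPolynomial_one (hβ : ∀ n, β n ≠ 0) (x : ℝ) :
    β 0 * (jacobiPolynomial β c 1).eval x = (x - c 0) * (jacobiPolynomial β c 0).eval x := by
  simp [jacobiPolynomial, mul_inv_cancel_left₀ (hβ 0)]

theorem mul_eval_jacobiPolynomial_add_two (hβ : ∀ n, β n ≠ 0) (n : ℕ) (x : ℝ) :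
    β (n + 1) * (jacobiPolynomial β c (n + 2)).eval x =
      (x - c (n + 1)) * (jacobiPolynomial β c (n + 1)).eval x
        - β n * (jacobiPolynomial β c n).eval x := by
  rw [jacobiPolynomial]
  simp [mul_inv_cancel_left₀ (hβ (n + 1))]

theorem degree_jacobiPolynomial (hβ : ∀ n, β n ≠ 0) (n : ℕ) :
    (jacobiPolynomial β c n).degree = n := by
  induction n using Nat.twoStepInduction with
  | zero => simp [jacobiPolynomial]
  | one =>
    rw [jacobiPolynomial, degree_C_mul (inv_ne_zero (hβ 0)), degree_X_sub_C]
    rfl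
  | more n ih1 ih2 =>
    rw [jacobiPolynomial, degree_C_mul (inv_ne_zero (hβ (n + 1))), degree_sub_eq_left_of_degree_lt]
    · rw [degree_mul, degree_X_sub_C, ih2]
      push_cast
      ring
    · rw [degree_C_mul (hβ n), degree_mul, degree_X_sub_C, ih2, ih1]
      norm_cast
      omega

end JacobiPolynomial

/-- The truncated Jacobi matrix with diagonal `c` and off-diagonal `β`. -/
def jacobiMatrix (β c : ℕ → ℝ) (N : ℕ) : Matrix (Fin (N + 1)) (Fin (N + 1)) ℝ :=
  Matrix.of fun i j =>
    if (i : ℕ) = j then c i else if (i : ℕ) + 1 = j then β i else if (j : ℕ) + 1 = i then β j else 0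

theorem isHermitian_jacobiMatrix (β c : ℕ → ℝ) (N : ℕ) : (jacobiMatrix β c N).IsHermitian := by
  refine Matrix.IsHermitian.ext fun i j => ?_
  simp only [jacobiMatrix, Matrix.of_apply, star_trivial]
  split_ifs <;> first | rfl | omega | skip
  next h h' => rw [h]

/-- An eigenvector of a truncated Jacobi matrix is determined by its first entry. -/
theorem eq_eval_jacobiPolynomial_mul {β c : ℕ → ℝ} (hβ : ∀ n, β n ≠ 0) {N : ℕ}
    {v : Fin (N + 1) → ℝ} {x : ℝ} (hv : (jacobiMatrix β c N).mulVec v = x • v)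
    (n : ℕ) (hn : n < N + 1) : v ⟨n, hn⟩ = (jacobiPolynomial β c n).eval x * v 0 := by
  -- Row n of the eigenvalue equation is the recurrence of the Jacobi polynomials at x; since β n ≠
  -- 0, it determines entry n + 1 from the earlier ones.
  have hrow (i : Fin (N + 1)) : ∑ j, jacobiMatrix β c N i j * v j = x * v i := by
    simpa [Matrix.mulVec, dotProduct] using congrFun hv i
  induction n using Nat.twoStepInduction with
  | zero => simp [jacobiPolynomial_zero]
  | one =>
    have h := hrow 0
    rw [Fintype.sum_eq_add (0 : Fin (N + 1)) ⟨1, hn⟩] at h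
    · have h1 := mul_eval_jacobiPolynomial_one (c := c) hβ x
      simp only [jacobiMatrix, Matrix.of_apply, Fin.val_zero, jacobiPolynomial_zero, eval_one]
        at h h1
      norm_num at h
      apply mul_left_cancel₀ (hβ 0)
      linear_combination h - v 0 * h1
    · simp [Fin.ext_iff]
    · rintro j ⟨hj0, hj1⟩
      simp only [ne_eq, Fin.ext_iff, Fin.val_zero] at hj0 hj1
      rw [jacobiMatrix, Matrix.of_apply, if_neg (by simp; omega), if_neg (by simp; omega),
        if_neg (by simp), zero_mul]
  | more n ih1 ih2 =>
    have h := hrow ⟨n + 1, by omega⟩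
    have hsub : ∑ j, jacobiMatrix β c N ⟨n + 1, by omega⟩ j * v j =
        ∑ j ∈ {⟨n, by omega⟩, ⟨n + 1, by omega⟩, ⟨n + 2, hn⟩},
          jacobiMatrix β c N ⟨n + 1, by omega⟩ j * v j := by
      refine (Finset.sum_subset (Finset.subset_univ _) fun j _ hj => ?_).symm
      simp only [Finset.mem_insert, Finset.mem_singleton, Fin.ext_iff, not_or] at hj
      simp only [jacobiMatrix, Matrix.of_apply]
      rw [if_neg (by omega), if_neg (by omega), if_neg (by omega), zero_mul]
    rw [hsub, Finset.sum_insert (by simp [Fin.ext_iff]), Finset.sum_insert (by simp [Fin.ext_iff]),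
      Finset.sum_singleton, ih1, ih2] at h
    have h1 := mul_eval_jacobiPolynomial_add_two (c := c) hβ n x
    simp only [jacobiMatrix, Matrix.of_apply] at h
    norm_num [show ¬ n + 1 + 1 = n by omega] at h
    apply mul_left_cancel₀ (hβ (n + 1))
    linear_combination h - v 0 * h1

/-- The spectral measure of a truncated Jacobi matrix makes the first Jacobi polynomials
orthonormal. -/
theorem exists_truncated_orthogonality_measure {β c : ℕ → ℝ} (hβ : ∀ n, β n ≠ 0) (N : ℕ) :
    ∃ ν : ProbabilityMeasure ℝ, HasFiniteMoments ν ∧ ∀ m n : ℕ, m ≤ N → n ≤ N →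
      ∫ ξ, (jacobiPolynomial β c m).eval ξ * (jacobiPolynomial β c n).eval ξ ∂(ν : Measure ℝ) =
        if m = n then 1 else 0 := by
  classical
  set hJ := isHermitian_jacobiMatrix β c N
  set U := hJ.eigenvectorUnitary with hU
  -- The weights of the spectral measure at the first basis vector: squared first entries of the
  -- normalized eigenvectors.
  set w : Fin (N + 1) → ℝ := fun i => (U : Matrix (Fin (N + 1)) (Fin (N + 1)) ℝ) 0 i ^ 2 with hw
  have hv (i : Fin (N + 1)) (n : ℕ) (hn : n < N + 1) : (U : Matrix (Fin (N + 1)) (Fin (N + 1)) ℝ) ⟨n, hn⟩ i =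
        (jacobiPolynomial β c n).eval (hJ.eigenvalues i) * (U : Matrix (Fin (N + 1)) (Fin (N + 1)) ℝ) 0 i := by
    simp only [hU, Matrix.IsHermitian.eigenvectorUnitary_apply]
    exact eq_eval_jacobiPolynomial_mul hβ (hJ.mulVec_eigenvectorBasis i) n hn
  have horth (m n : ℕ) (hm : m ≤ N) (hn : n ≤ N) :
      ∑ i, w i * ((jacobiPolynomial β c m).eval (hJ.eigenvalues i) *
        (jacobiPolynomial β c n).eval (hJ.eigenvalues i)) = if m = n then 1 else 0 := by
    -- The rows of U, not only its eigenvector columns, are orthonormal; by `hv`, rows m and n carry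
    -- the values of the m-th and n-th polynomials at the eigenvalues.
    have h := congrFun (congrFun (Matrix.mem_unitaryGroup_iff.1 U.2) ⟨m, Nat.lt_succ_of_le hm⟩)
      ⟨n, Nat.lt_succ_of_le hn⟩
    rw [Matrix.mul_apply, Matrix.one_apply] at h
    simp only [Fin.mk.injEq] at h
    rw [← h]
    refine Finset.sum_congr rfl fun i _ => ?_
    rw [Matrix.star_apply, star_trivial, hv i m, hv i n]
    simp only [hw]
    ring
  set ν : Measure ℝ := ∑ i, ENNReal.ofReal (w i) • Measure.dirac (hJ.eigenvalues i) with hν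
  have hint (f : ℝ → ℝ) : Integrable f ν := by
    rw [hν, integrable_finsetSum_measure]
    exact fun i _ => (integrable_dirac (by simp)).smul_measure ENNReal.ofReal_ne_top
  have hval (f : ℝ → ℝ) : ∫ ξ, f ξ ∂ν = ∑ i, w i * f (hJ.eigenvalues i) := by
    rw [hν, integral_finsetSum_measure
      fun i _ => (integrable_dirac (by simp)).smul_measure ENNReal.ofReal_ne_top]
    refine Finset.sum_congr rfl fun i _ => ?_
    rw [integral_smul_measure, integral_dirac, ENNReal.toReal_ofReal (sq_nonneg _), smul_eq_mul]
  have hprob : IsProbabilityMeasure ν := by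
    constructor
    have h := horth 0 0 (Nat.zero_le _) (Nat.zero_le _)
    simp only [jacobiPolynomial_zero, eval_one, mul_one, if_true] at h
    simp only [hν, Measure.coe_finsetSum, Finset.sum_apply, Measure.smul_apply, measure_univ,
      smul_eq_mul, mul_one]
    rw [← ENNReal.ofReal_sum_of_nonneg fun i _ => sq_nonneg _, h, ENNReal.ofReal_one]
  refine ⟨⟨ν, hprob⟩, fun n => hint _, fun m n hm hn => ?_⟩
  rw [← horth m n hm hn]
  exact hval _

/-! ### Weak limits under moment bounds. -/

/-- A nonnegative continuous function whose integrals are bounded along a weakly convergent family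
of probability measures is integrable for the limit, with the same bound. -/
theorem integrable_of_tendsto_of_integral_le {ι : Type*} {l : Filter ι} [l.NeBot]
    {ν : ι → ProbabilityMeasure ℝ} {μ : ProbabilityMeasure ℝ} (hν : Tendsto ν l (𝓝 μ))
    {f : ℝ → ℝ} (hf : Continuous f) (hf0 : ∀ x, 0 ≤ f x)
    (hint : ∀ i, Integrable f (ν i : Measure ℝ)) {B : ℝ}
    (hB : ∀ i, ∫ x, f x ∂(ν i : Measure ℝ) ≤ B) :
    Integrable f (μ : Measure ℝ) ∧ ∫ x, f x ∂(μ : Measure ℝ) ≤ B := by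
  -- Weak convergence only tests bounded functions, so f is cut off at n; monotone convergence then
  -- removes the cutoff.
  have hmin (n : ℕ) : ∫ x, min (f x) n ∂(μ : Measure ℝ) ≤ B := by
    let F : BoundedContinuousFunction ℝ ℝ :=
      BoundedContinuousFunction.ofNormedAddCommGroup (fun x => min (f x) n)
        (hf.min continuous_const) n fun x => by
          rw [Real.norm_of_nonneg (le_min (hf0 x) n.cast_nonneg)]
          exact min_le_right _ _
    refine le_of_tendsto (ProbabilityMeasure.tendsto_iff_forall_integral_tendsto.1 hν F)
      (Eventually.of_forall fun i => le_trans ?_ (hB i))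
    exact integral_mono (F.integrable _) (hint i) fun x => min_le_left _ _
  have hB0 : 0 ≤ B :=
    (integral_nonneg fun x => le_min (hf0 x) (Nat.cast_nonneg 0)).trans (hmin 0)
  have hlint : ∫⁻ x, ENNReal.ofReal (f x) ∂(μ : Measure ℝ) ≤ ENNReal.ofReal B := by
    have hsup (x : ℝ) : ENNReal.ofReal (f x) = ⨆ n : ℕ, ENNReal.ofReal (min (f x) n) := by
      refine le_antisymm ?_ (iSup_le fun n => ENNReal.ofReal_le_ofReal (min_le_left _ _))
      obtain ⟨n, hn⟩ := exists_nat_ge (f x)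
      exact le_iSup_of_le n (by rw [min_eq_left hn])
    simp only [hsup]
    rw [lintegral_iSup]
    · refine iSup_le fun n => ?_
      rw [← ofReal_integral_eq_lintegral_ofReal]
      · exact ENNReal.ofReal_le_ofReal (hmin n)
      · refine Integrable.of_bound (hf.min continuous_const).aestronglyMeasurable n
          (ae_of_all _ fun x => ?_)
        rw [Real.norm_of_nonneg (le_min (hf0 x) n.cast_nonneg)]
        exact min_le_right _ _
      · exact ae_of_all _ fun x => le_min (hf0 x) n.cast_nonneg
    · exact fun n => (hf.min continuous_const).measurable.ennreal_ofReal
    · intro m n hmn x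
      exact ENNReal.ofReal_le_ofReal (min_le_min_left _ (by exact_mod_cast hmn))
  have hfi : Integrable f (μ : Measure ℝ) := by
    refine ⟨hf.aestronglyMeasurable, ?_⟩
    rw [hasFiniteIntegral_iff_ofReal (ae_of_all _ hf0)]
    exact hlint.trans_lt ENNReal.ofReal_lt_top
  refine ⟨hfi, ?_⟩
  rw [← ofReal_integral_eq_lintegral_ofReal hfi (ae_of_all _ hf0)] at hlint
  exact (ENNReal.ofReal_le_ofReal_iff hB0).1 hlint

theorem abs_sub_clamp_le {y R : ℝ} (hR : 0 < R) : |y - max (-R) (min R y)| ≤ y ^ 2 / R := by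
  have h0 : 0 ≤ y ^ 2 / R := by positivity
  rcases le_total R y with h | h
  · rw [min_eq_left h, max_eq_right (by linarith), abs_of_nonneg (by linarith), le_div_iff₀ hR]
    nlinarith
  · rw [min_eq_right h]
    rcases le_total (-R) y with h' | h'
    · rwa [max_eq_right h', sub_self, abs_zero]
    · rw [max_eq_left h', abs_of_nonpos (by linarith), le_div_iff₀ hR]
      nlinarith

/-- Integrals of a continuous function converge along a weakly convergent family of probability
measures, provided the second moments of the function are bounded. -/
theorem tendsto_integral_of_integral_sq_le {ι : Type*} {l : Filter ι} [l.NeBot]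
    {ν : ι → ProbabilityMeasure ℝ} {μ : ProbabilityMeasure ℝ} (hν : Tendsto ν l (𝓝 μ))
    {f : ℝ → ℝ} (hf : Continuous f)
    (hint : ∀ i, Integrable (fun x => f x ^ 2) (ν i : Measure ℝ)) {B : ℝ}
    (hB : ∀ i, ∫ x, f x ^ 2 ∂(ν i : Measure ℝ) ≤ B) :
    Integrable f (μ : Measure ℝ) ∧
      Tendsto (fun i => ∫ x, f x ∂(ν i : Measure ℝ)) l (𝓝 (∫ x, f x ∂(μ : Measure ℝ))) := by
  have hμ := integrable_of_tendsto_of_integral_le hν (hf.pow 2) (fun x => sq_nonneg _) hint hB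
  -- Clamping f to [-R, R] costs at most B / R, uniformly over the family and its limit, so an ε/3
  -- argument applies.
  have hclamp (R : ℝ) (hR : 0 < R) (P : ProbabilityMeasure ℝ)
      (h1 : Integrable (fun x => f x ^ 2) (P : Measure ℝ))
      (h2 : ∫ x, f x ^ 2 ∂(P : Measure ℝ) ≤ B) : Integrable f (P : Measure ℝ) ∧
      |∫ x, f x ∂(P : Measure ℝ) - ∫ x, max (-R) (min R (f x)) ∂(P : Measure ℝ)| ≤ B / R := by
    have hfi : Integrable f (P : Measure ℝ) :=
      ((memLp_two_iff_integrable_sq hf.aestronglyMeasurable).2 h1).integrable one_le_two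
    have hci : Integrable (fun x => max (-R) (min R (f x))) (P : Measure ℝ) := by
      refine Integrable.of_bound
        (continuous_const.max (continuous_const.min hf)).aestronglyMeasurable R
        (ae_of_all _ fun x => ?_)
      rw [Real.norm_eq_abs, abs_le]
      exact ⟨le_max_left _ _, max_le (by linarith) (min_le_left _ _)⟩
    refine ⟨hfi, ?_⟩
    rw [← integral_sub hfi hci]
    calc _ ≤ ∫ x, |f x - max (-R) (min R (f x))| ∂(P : Measure ℝ) := abs_integral_le_integral_abs
      _ ≤ ∫ x, f x ^ 2 / R ∂(P : Measure ℝ) :=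
        integral_mono (hfi.sub hci).abs (h1.div_const R) fun x => abs_sub_clamp_le hR
      _ ≤ B / R := by
        rw [integral_div]
        gcongr
  refine ⟨(hclamp 1 one_pos μ hμ.1 hμ.2).1, ?_⟩
  rw [Metric.tendsto_nhds]
  intro ε hε
  obtain ⟨R, hR, hRε⟩ : ∃ R : ℝ, 0 < R ∧ B / R < ε / 3 := by
    have h : Tendsto (fun R : ℝ => B / R) atTop (𝓝 0) := tendsto_const_nhds.div_atTop tendsto_id
    obtain ⟨R, h1, h2⟩ := ((eventually_gt_atTop 0).and (h.eventually_lt_const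
      (show (0 : ℝ) < ε / 3 by positivity))).exists
    exact ⟨R, h1, h2⟩
  let F : BoundedContinuousFunction ℝ ℝ :=
    BoundedContinuousFunction.ofNormedAddCommGroup (fun x => max (-R) (min R (f x)))
      (continuous_const.max (continuous_const.min hf)) R fun x => by
        rw [Real.norm_eq_abs, abs_le]
        exact ⟨le_max_left _ _, max_le (by linarith) (min_le_left _ _)⟩
  have hF := Metric.tendsto_nhds.1
    (ProbabilityMeasure.tendsto_iff_forall_integral_tendsto.1 hν F) (ε / 3) (by positivity)
  filter_upwards [hF] with i hi
  have h1 := (hclamp R hR (ν i) (hint i) (hB i)).2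
  have h2 := (hclamp R hR μ hμ.1 hμ.2).2
  rw [Real.dist_eq] at hi ⊢
  change |∫ x, max (-R) (min R (f x)) ∂(ν i : Measure ℝ)
    - ∫ x, max (-R) (min R (f x)) ∂(μ : Measure ℝ)| < ε / 3 at hi
  rw [abs_lt] at hi ⊢
  rw [abs_le] at h1 h2
  constructor <;> linarith [h1.1, h1.2, h2.1, h2.2, hi.1, hi.2]

/-- A family of probability measures on `ℝ` with bounded second moments is tight. -/
theorem isTightMeasureSet_of_integral_sq_le {S : Set (ProbabilityMeasure ℝ)} {B : ℝ}
    (hint : ∀ ν ∈ S, Integrable (fun x : ℝ => x ^ 2) (ν : Measure ℝ))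
    (hB : ∀ ν ∈ S, ∫ x, x ^ 2 ∂(ν : Measure ℝ) ≤ B) :
    IsTightMeasureSet {((ν : ProbabilityMeasure ℝ) : Measure ℝ) | ν ∈ S} := by
  apply isTightMeasureSet_of_tendsto_measure_norm_gt
  have hlim : Tendsto (fun r : ℝ => ENNReal.ofReal (B / r ^ 2)) atTop (𝓝 0) := by
    rw [← ENNReal.ofReal_zero]
    exact ENNReal.tendsto_ofReal
      (tendsto_const_nhds.div_atTop (tendsto_pow_atTop two_ne_zero))
  refine tendsto_of_tendsto_of_tendsto_of_le_of_le' tendsto_const_nhds hlim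
    (Eventually.of_forall fun _ => zero_le) ?_
  filter_upwards [eventually_gt_atTop 0] with r hr
  refine iSup₂_le fun m hm => ?_
  obtain ⟨ν, hν, rfl⟩ := hm
  have hcheb := mul_meas_ge_le_integral_of_nonneg (ae_of_all _ fun x => sq_nonneg x) (hint ν hν)
    (r ^ 2)
  have hsub : {x : ℝ | r < ‖x‖} ⊆ {x : ℝ | r ^ 2 ≤ x ^ 2} := fun x hx => by
    rw [Set.mem_ofPred_eq, ← sq_abs x]
    exact pow_le_pow_left₀ hr.le hx.le 2
  refine (measure_mono hsub).trans ?_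
  rw [← ofReal_measureReal]
  refine ENNReal.ofReal_le_ofReal ?_
  rw [le_div_iff₀ (by positivity), mul_comm]
  exact hcheb.trans (hB ν hν)

/-! ### Infinite support and Favard's theorem. -/

/-- An orthonormal polynomial system only exists for measures of infinite support. -/
theorem IsOrthonormalPolynomialSystem.infinite_support {p : ℕ → ℝ[X]} {μ : Measure ℝ}
    (hp : IsOrthonormalPolynomialSystem p μ) (hμ : HasFiniteMoments μ) : μ.support.Infinite := by
  intro hfin
  set q : ℝ[X] := ∏ s ∈ hfin.toFinset, (X - C s) with hq
  have hq0 : q ≠ 0 := (monic_prod_X_sub_C id _).ne_zero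
  -- A nonzero polynomial vanishing on a finite support is null in L²(μ), so all its expansion
  -- coefficients vanish, a contradiction.
  have hae : ∀ᵐ ξ ∂μ, q.eval ξ = 0 := by
    filter_upwards [Measure.support_mem_ae] with ξ hξ
    rw [hq, eval_prod]
    exact Finset.prod_eq_zero (hfin.mem_toFinset.2 hξ) (by simp)
  apply hq0
  rw [hp.eq_sum_integral hμ (le_refl q.natDegree)]
  refine Finset.sum_eq_zero fun k _ => ?_
  have : ∫ ξ, q.eval ξ * (p k).eval ξ ∂μ = 0 := by
    refine integral_eq_zero_of_ae ?_
    filter_upwards [hae] with ξ hξ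
    simp [hξ]
  rw [this, C_0, zero_mul]

/-- Favard's theorem. -/
theorem exists_orthogonality_measure {β c : ℕ → ℝ} (hβ : ∀ n, β n ≠ 0) :
    ∃ μ : Measure ℝ, IsProbabilityMeasure μ ∧ HasFiniteMoments μ ∧
      IsOrthonormalPolynomialSystem (jacobiPolynomial β c) μ := by
  choose ν hνm hν using exists_truncated_orthogonality_measure (c := c) hβ
  set p := jacobiPolynomial β c with hp
  -- Since p₀ = 1, the integral is the coefficient of p₀ in q as soon as N ≥ deg q.
  have hev (q : ℝ[X]) : ∃ a, ∀ᶠ N in atTop, ∫ ξ, q.eval ξ ∂(ν N : Measure ℝ) = a := by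
    obtain ⟨a, ha⟩ := exists_eq_sum_of_degree_eq (degree_jacobiPolynomial (c := c) hβ) _ q le_rfl
    refine ⟨a 0, ?_⟩
    filter_upwards [eventually_ge_atTop q.natDegree] with N hN
    have h (ξ : ℝ) : q.eval ξ = ∑ k ∈ Finset.range (q.natDegree + 1),
        a k * ((p k).eval ξ * (p 0).eval ξ) := by
      conv_lhs => rw [ha]
      simp [eval_finsetSum, hp, jacobiPolynomial_zero]
    simp only [h]
    rw [integral_finsetSum]
    · rw [Finset.sum_eq_single 0]
      · rw [integral_const_mul, hν N 0 0 (Nat.zero_le _) (Nat.zero_le _)]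
        simp
      · intro k hk hk0
        rw [integral_const_mul, hν N k 0 (by have := Finset.mem_range.1 hk; omega) (Nat.zero_le _),
          if_neg hk0, mul_zero]
      · simp
    · intro k _
      refine Integrable.const_mul ?_ _
      simpa using (hνm N).integrable_eval (p k * p 0)
  have hbdd (q : ℝ[X]) : ∃ B, ∀ N, ∫ ξ, q.eval ξ ∂(ν N : Measure ℝ) ≤ B := by
    obtain ⟨a, ha⟩ := hev q
    obtain ⟨B, hB⟩ := (tendsto_const_nhds.congr' (ha.mono fun _ h => h.symm) :
      Tendsto (fun N => ∫ ξ, q.eval ξ ∂(ν N : Measure ℝ)) atTop (𝓝 a)).bddAbove_range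
    exact ⟨B, fun N => hB ⟨N, rfl⟩⟩
  have htight : IsTightMeasureSet {((P : ProbabilityMeasure ℝ) : Measure ℝ) | P ∈ Set.range ν} := by
    obtain ⟨B, hB⟩ := hbdd (X ^ 2)
    refine isTightMeasureSet_of_integral_sq_le (B := B) ?_ ?_
    · rintro _ ⟨N, rfl⟩
      exact hνm N 2
    · rintro _ ⟨N, rfl⟩
      simpa using hB N
  -- Prokhorov compactness; a limit along a free ultrafilter replaces the choice of a subsequence.
  obtain ⟨μ, -, hμ⟩ := (isCompact_closure_of_isTightMeasureSet htight).ultrafilter_le_nhds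
    ((hyperfilter ℕ).map ν) (le_principal_iff.2
      (mem_map.2 (univ_mem' fun N => subset_closure ⟨N, rfl⟩)))
  have hlim : Tendsto ν (hyperfilter ℕ) (𝓝 μ) := hμ
  have hpoly (q : ℝ[X]) : Integrable (fun ξ => q.eval ξ) (μ : Measure ℝ) ∧
      Tendsto (fun N => ∫ ξ, q.eval ξ ∂(ν N : Measure ℝ)) (hyperfilter ℕ)
        (𝓝 (∫ ξ, q.eval ξ ∂(μ : Measure ℝ))) := by
    obtain ⟨B, hB⟩ := hbdd (q ^ 2)
    refine tendsto_integral_of_integral_sq_le (B := B) hlim q.continuous (fun N => ?_) fun N => ?_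
    · exact ((hνm N).integrable_eval (q ^ 2)).congr (ae_of_all _ fun ξ => eval_pow 2)
    · simpa only [eval_pow] using hB N
  refine ⟨μ, inferInstance, fun n => by simpa using (hpoly (X ^ n)).1,
    degree_jacobiPolynomial hβ, fun m n => ?_⟩
  have h := (hpoly (p m * p n)).2
  simp only [eval_mul] at h
  refine tendsto_nhds_unique h (tendsto_const_nhds.congr' ?_)
  have hle : (hyperfilter ℕ : Filter ℕ) ≤ atTop := Nat.hyperfilter_le_atTop
  filter_upwards [hle (eventually_ge_atTop (max m n))] with N hN
  exact (hν N m n ((le_max_left _ _).trans hN) ((le_max_right _ _).trans hN)).symm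

/-! ### Fourier transforms in L², tested against Schwartz functions. -/

section Fourier

open scoped FourierTransform SchwartzMap

/-- Two locally integrable functions with equal integrals against Schwartz functions are equal
almost everywhere. -/
theorem ae_eq_of_integral_schwartzMap_mul_eq {f f' : ℝ → ℂ} (hf : LocallyIntegrable f volume)
    (hf' : LocallyIntegrable f' volume) (h : ∀ u : 𝓢(ℝ, ℂ), ∫ x, u x * f x = ∫ x, u x * f' x) :
    f =ᵐ[volume] f' := by
  refine ae_eq_of_integral_contDiff_smul_eq hf hf' fun g hg hgc => ?_
  have h1 : HasCompactSupport (Complex.ofRealCLM ∘ g) := hgc.comp_left rfl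
  have h2 : ContDiff ℝ (⊤ : ℕ∞) (Complex.ofRealCLM ∘ g) := Complex.ofRealCLM.contDiff.comp hg
  simpa using h (h1.toSchwartzMap h2)

theorem MeasureTheory.Lp.integral_schwartzMap_mul_fourier (f : Lp ℂ 2 (volume : Measure ℝ))
    (u : 𝓢(ℝ, ℂ)) : ∫ x, u x * (𝓕 f : Lp ℂ 2 (volume : Measure ℝ)) x = ∫ x, 𝓕 u x * f x := by
  have h := congrArg (fun T => T u) (Lp.fourier_toTemperedDistribution_eq f)
  simpa using h.symm

theorem MeasureTheory.Lp.integral_schwartzMap_mul_fourierInv (f : Lp ℂ 2 (volume : Measure ℝ))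
    (u : 𝓢(ℝ, ℂ)) : ∫ x, u x * (𝓕⁻ f : Lp ℂ 2 (volume : Measure ℝ)) x = ∫ x, 𝓕⁻ u x * f x := by
  have h := congrArg (fun T => T u) (Lp.fourierInv_toTemperedDistribution_eq f)
  simpa using h.symm

/-- The `L²` Fourier transform of a derivative. -/
theorem fourier_toLp_deriv {f f' : ℝ → ℂ} (hf : MemLp f 2 volume) (hf' : MemLp f' 2 volume)
    (hd : ∀ x, HasDerivAt f (f' x) x) :
    (𝓕 (hf'.toLp f') : Lp ℂ 2 (volume : Measure ℝ)) =ᵐ[volume] fun ξ : ℝ =>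
      2 * Real.pi * Complex.I * ξ * (𝓕 (hf.toLp f) : Lp ℂ 2 (volume : Measure ℝ)) ξ := by
  set F : Lp ℂ 2 (volume : Measure ℝ) := 𝓕 (hf.toLp f) with hF
  have hparts (u : 𝓢(ℝ, ℂ)) : ∫ x, u x * f' x = -∫ x, deriv u x * f x := by
    have hu' : MemLp (deriv u) 2 volume := (SchwartzMap.derivCLM ℂ ℂ u).memLp 2 volume
    exact integral_mul_deriv_eq_deriv_mul_of_integrable
      (fun x _ => (u.differentiable x).hasDerivAt) (fun x _ => hd x)
      ((u.memLp 2 volume).integrable_mul hf') (hu'.integrable_mul hf)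
      ((u.memLp 2 volume).integrable_mul hf)
  refine ae_eq_of_integral_schwartzMap_mul_eq ((Lp.memLp _).locallyIntegrable one_le_two) ?_
    fun u => ?_
  · exact ((Lp.memLp F).locallyIntegrable one_le_two).continuous_mul (by fun_prop)
  -- Chosen so that 𝓕 v is the derivative of 𝓕 u; integration by parts then moves the derivative
  -- from f to the test function.
  · set v : 𝓢(ℝ, ℂ) := -(2 * Real.pi * Complex.I) •
      SchwartzMap.smulLeftCLM ℂ (fun x : ℝ => inner ℝ x (1 : ℝ)) u with hv
    have hv_apply (x : ℝ) : v x = -(2 * Real.pi * Complex.I) * (x * u x) := by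
      rw [hv, smul_apply, SchwartzMap.smulLeftCLM_apply_apply (by fun_prop)]
      simp
    have hderiv (x : ℝ) : deriv (𝓕 u : 𝓢(ℝ, ℂ)) x = 𝓕 v x := by
      rw [hv, ← SchwartzMap.lineDerivOp_fourier_eq, SchwartzMap.lineDerivOp_apply_eq_fderiv]
      simp
    rw [Lp.integral_schwartzMap_mul_fourier]
    calc ∫ x, 𝓕 u x * hf'.toLp f' x = ∫ x, 𝓕 u x * f' x :=
          integral_congr_ae (hf'.coeFn_toLp.mono fun x hx => by simp only [hx])
      _ = -∫ x, deriv (𝓕 u : 𝓢(ℝ, ℂ)) x * f x := hparts _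
      _ = -∫ x, 𝓕 v x * hf.toLp f x := by
          congr 1
          exact integral_congr_ae (hf.coeFn_toLp.mono fun x hx => by simp only [hx, hderiv])
      _ = -∫ x, v x * F x := by rw [hF, Lp.integral_schwartzMap_mul_fourier]
      _ = _ := by
          rw [← integral_neg]
          congr 1
          ext x
          rw [hv_apply]
          ring

/-- The abstract L² transform and the integral formula can both be moved onto a Schwartz test
function, so they define the same distribution. -/
theorem fourierInv_toLp_ae_eq {h : ℝ → ℂ} (h2 : MemLp h 2 volume) (h1 : Integrable h volume) :
    (𝓕⁻ (h2.toLp h) : Lp ℂ 2 (volume : Measure ℝ)) =ᵐ[volume] 𝓕⁻ h := by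
  have hcont : Continuous (𝓕⁻ h) :=
    VectorFourier.fourierIntegral_continuous Real.continuous_fourierChar
      (by simp only [LinearMap.neg_apply, innerₗ_apply_apply]; fun_prop) h1
  refine ae_eq_of_integral_schwartzMap_mul_eq ((Lp.memLp _).locallyIntegrable one_le_two)
    hcont.locallyIntegrable fun u => ?_
  rw [Lp.integral_schwartzMap_mul_fourierInv]
  calc ∫ x, 𝓕⁻ u x * h2.toLp h x = ∫ x, 𝓕⁻ (u : ℝ → ℂ) x * h x :=
        integral_congr_ae (h2.coeFn_toLp.mono fun x hx => by
          simp only [hx, SchwartzMap.fourierInv_coe])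
    _ = ∫ x, u x * 𝓕⁻ h x := by
        have hflip : (-innerₗ ℝ).flip = -innerₗ ℝ := by
          ext
          simp
        have := VectorFourier.integral_bilin_fourierIntegral_eq_flip (.mul ℂ ℂ) (L := -innerₗ ℝ)
          (μ := volume) (ν := volume) Real.continuous_fourierChar
          (by simp only [LinearMap.neg_apply, innerₗ_apply_apply]; fun_prop) u.integrable h1
        rw [hflip] at this
        exact this

end Fourier

/-! ### Rapid decay and integrability. -/

/-- A function decays faster than any power in the `L²` sense iff its product with each power is
square integrable. -/
theorem rapidlyDecaying_iff_forall_memLp {g : ℝ → ℂ} (hg : MemLp g 2 volume) :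
    RapidlyDecaying g ↔ ∀ n : ℕ, MemLp (fun ξ : ℝ => (ξ : ℂ) ^ n * g ξ) 2 volume := by
  refine forall_congr' fun n => ?_
  have hmeas : AEStronglyMeasurable (fun ξ : ℝ => (ξ : ℂ) ^ n * g ξ) volume :=
    (by fun_prop : Continuous fun ξ : ℝ => (ξ : ℂ) ^ n).aestronglyMeasurable.mul
      hg.aestronglyMeasurable
  have hms (R : ℝ) : MeasurableSet {ξ : ℝ | R < |ξ|} :=
    measurableSet_lt measurable_const measurable_id.abs
  constructor
  · intro h
    -- One R with a finite tail norm is enough: on the complement the power is bounded by |R| ^ n.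
    obtain ⟨R, hR⟩ := (h.eventually_lt_const (show (0 : ENNReal) < 1 from one_pos)).exists
    have hout : MemLp ({ξ : ℝ | R < |ξ|}.indicator fun ξ : ℝ => (ξ : ℂ) ^ n * g ξ) 2 volume := by
      rw [memLp_indicator_iff_restrict (hms R)]
      exact ⟨hmeas.restrict, hR.trans ENNReal.one_lt_top⟩
    have hin : MemLp ({ξ : ℝ | R < |ξ|}ᶜ.indicator fun ξ : ℝ => (ξ : ℂ) ^ n * g ξ) 2 volume := by
      refine MemLp.of_le_mul (c := |R| ^ n) hg (hmeas.indicator (hms R).compl)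
        (ae_of_all _ fun ξ => ?_)
      by_cases hξ : R < |ξ|
      · rw [Set.indicator_of_notMem (by simpa using hξ), norm_zero]
        positivity
      · rw [Set.indicator_of_mem (by simpa using hξ), norm_mul, norm_pow, Complex.norm_real,
          Real.norm_eq_abs]
        exact mul_le_mul_of_nonneg_right (pow_le_pow_left₀ (abs_nonneg _)
          ((not_lt.1 hξ).trans (le_abs_self R)) n) (norm_nonneg _)
    simpa using (hout.add hin).congr_norm hmeas
      (ae_of_all _ fun ξ => by rw [Pi.add_apply, Set.indicator_self_add_compl_apply])
  · intro h
    have hfin := h.eLpNorm_lt_top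
    rw [eLpNorm_lt_top_iff_lintegral_rpow_enorm_lt_top two_ne_zero ENNReal.ofNat_ne_top] at hfin
    have hlim : Tendsto (fun R : ℝ => ∫⁻ ξ in {ξ : ℝ | R < |ξ|},
        ‖(ξ : ℂ) ^ n * g ξ‖ₑ ^ (2 : ENNReal).toReal) atTop (𝓝 0) := by
      have h0 : ∫⁻ _ : ℝ, (0 : ENNReal) = 0 := lintegral_zero
      simp only [← lintegral_indicator (hms _)]
      rw [← h0]
      refine tendsto_lintegral_filter_of_dominated_convergence'
        (fun ξ => ‖(ξ : ℂ) ^ n * g ξ‖ₑ ^ (2 : ENNReal).toReal) (Eventually.of_forall fun R => ?_)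
        (Eventually.of_forall fun R => ae_of_all _ fun ξ => Set.indicator_le_self _ _ _)
        hfin.ne (ae_of_all _ fun ξ => ?_)
      · exact (hmeas.enorm.pow_const _).indicator (hms R)
      · refine tendsto_const_nhds.congr' ?_
        filter_upwards [eventually_ge_atTop |ξ|] with R hR
        rw [Set.indicator_of_notMem (by simpa using hR)]
    simp only [eLpNorm_eq_lintegral_rpow_enorm_toReal two_ne_zero ENNReal.ofNat_ne_top]
    have := hlim.ennrpow_const (1 / (2 : ENNReal).toReal)
    simpa using this

section Polynomial

variable {g : ℝ → ℂ}

theorem RapidlyDecaying.memLp_eval_mul (hr : RapidlyDecaying g) (hg : MemLp g 2 volume)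
    (q : ℝ[X]) : MemLp (fun ξ : ℝ => ((q.eval ξ : ℝ) : ℂ) * g ξ) 2 volume := by
  have h (ξ : ℝ) : ((q.eval ξ : ℝ) : ℂ) * g ξ =
      ∑ i ∈ Finset.range (q.natDegree + 1), (q.coeff i : ℂ) * ((ξ : ℂ) ^ i * g ξ) := by
    rw [eval_eq_sum_range]
    push_cast
    rw [Finset.sum_mul]
    simp only [mul_assoc]
  simp only [h]
  exact memLp_finsetSum _ fun i _ => ((rapidlyDecaying_iff_forall_memLp hg).1 hr i).const_mul _

/-- A function `h` for which `h` and `ξ h` are square integrable is integrable. -/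
theorem integrable_of_memLp_two_of_memLp_two_mul {h : ℝ → ℂ} (h0 : MemLp h 2 volume)
    (h1 : MemLp (fun ξ : ℝ => (ξ : ℂ) * h ξ) 2 volume) : Integrable h volume := by
  -- Cauchy–Schwarz: h is the product of this L² weight and (1 + iξ) h, which is in L².
  have hw : MemLp (fun ξ : ℝ => (1 + (ξ : ℂ) * Complex.I)⁻¹) 2 volume := by
    have hne (ξ : ℝ) : (1 + (ξ : ℂ) * Complex.I) ≠ 0 := fun h => by
      have := congrArg Complex.re h
      simp at this
    have hm : AEStronglyMeasurable (fun ξ : ℝ => (1 + (ξ : ℂ) * Complex.I)⁻¹) volume :=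
      (Continuous.inv₀ (by fun_prop) hne).aestronglyMeasurable
    rw [memLp_two_iff_integrable_sq_norm hm]
    refine integrable_inv_one_add_sq.congr (ae_of_all _ fun ξ => ?_)
    beta_reduce
    rw [norm_inv, inv_pow, ← Complex.normSq_eq_norm_sq]
    simp [Complex.normSq_apply, sq]
  refine (hw.integrable_mul (h0.add (h1.mul_const Complex.I))).congr (ae_of_all _ fun ξ => ?_)
  have hne : (1 + (ξ : ℂ) * Complex.I) ≠ 0 := fun h => by
    have := congrArg Complex.re h
    simp at this
  simp only [Pi.mul_apply, Pi.add_apply]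
  field_simp

theorem RapidlyDecaying.integrable_eval_mul (hr : RapidlyDecaying g) (hg : MemLp g 2 volume)
    (q : ℝ[X]) : Integrable (fun ξ : ℝ => ((q.eval ξ : ℝ) : ℂ) * g ξ) volume := by
  refine integrable_of_memLp_two_of_memLp_two_mul (hr.memLp_eval_mul hg q) ?_
  refine (hr.memLp_eval_mul hg (X * q)).ae_eq (ae_of_all _ fun ξ => ?_)
  simp only [eval_mul, eval_X]
  push_cast
  ring

end Polynomial

/-! ### Fourier integrals of polynomial multiples: from (ii) to (i). -/

/-- The Fourier-type integral `∫ e^{ixξ} q(ξ) g(ξ) dξ`. -/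
noncomputable def polynomialFourierIntegral (g : ℝ → ℂ) (q : ℝ[X]) (x : ℝ) : ℂ :=
  ∫ ξ : ℝ, Complex.exp (Complex.I * (x : ℂ) * (ξ : ℂ)) * ((q.eval ξ : ℝ) : ℂ) * g ξ

section PolynomialFourierIntegral

variable {g : ℝ → ℂ}

theorem norm_exp_I_mul_ofReal_mul_ofReal (x ξ : ℝ) :
    ‖Complex.exp (Complex.I * (x : ℂ) * (ξ : ℂ))‖ = 1 := by
  rw [mul_assoc, mul_comm, ← Complex.ofReal_mul, Complex.norm_exp_ofReal_mul_I]

theorem integrable_exp_mul_eval_mul (hr : RapidlyDecaying g) (hg : MemLp g 2 volume) (q : ℝ[X])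
    (x : ℝ) : Integrable (fun ξ : ℝ =>
      Complex.exp (Complex.I * (x : ℂ) * (ξ : ℂ)) * ((q.eval ξ : ℝ) : ℂ) * g ξ) volume := by
  simp only [mul_assoc _ _ (g _)]
  exact (hr.integrable_eval_mul hg q).bdd_mul (c := 1)
    (by fun_prop : Continuous fun ξ : ℝ =>
      Complex.exp (Complex.I * (x : ℂ) * (ξ : ℂ))).aestronglyMeasurable
    (ae_of_all _ fun ξ => (norm_exp_I_mul_ofReal_mul_ofReal x ξ).le)

theorem hasDerivAt_polynomialFourierIntegral (hr : RapidlyDecaying g) (hg : MemLp g 2 volume)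
    (q : ℝ[X]) (x : ℝ) : HasDerivAt (polynomialFourierIntegral g q)
      (Complex.I * polynomialFourierIntegral g (X * q) x) x := by
  obtain ⟨r, hqr⟩ : ∃ r : ℝ[X], r = X * q := ⟨_, rfl⟩
  rw [← hqr]
  have h := (hasDerivAt_integral_of_dominated_loc_of_deriv_le
    (F := fun (x : ℝ) (ξ : ℝ) =>
      Complex.exp (Complex.I * (x : ℂ) * (ξ : ℂ)) * ((q.eval ξ : ℝ) : ℂ) * g ξ)
    (F' := fun (x : ℝ) (ξ : ℝ) => Complex.I *
      (Complex.exp (Complex.I * (x : ℂ) * (ξ : ℂ)) * ((r.eval ξ : ℝ) : ℂ) * g ξ))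
    (bound := fun ξ => ‖((r.eval ξ : ℝ) : ℂ) * g ξ‖) (x₀ := x) (μ := volume) univ_mem
    (Eventually.of_forall fun y => (integrable_exp_mul_eval_mul hr hg q y).aestronglyMeasurable)
    (integrable_exp_mul_eval_mul hr hg q x)
    ((integrable_exp_mul_eval_mul hr hg r x).const_mul _).aestronglyMeasurable
    (ae_of_all _ fun ξ y _ => ?_) (hr.integrable_eval_mul hg r).norm
    (ae_of_all _ fun ξ y _ => ?_)).2
  · rw [integral_const_mul] at h
    exact h
  · rw [norm_mul, Complex.norm_I, one_mul, mul_assoc, norm_mul,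
      norm_exp_I_mul_ofReal_mul_ofReal, one_mul]
  · have h1 : HasDerivAt (fun y : ℝ => Complex.I * (y : ℂ) * (ξ : ℂ)) (Complex.I * 1 * ξ) y :=
      ((Complex.ofRealCLM.hasDerivAt (x := y)).const_mul Complex.I).mul_const (ξ : ℂ)
    refine ((h1.cexp.mul_const ((q.eval ξ : ℝ) : ℂ)).mul_const (g ξ)).congr_deriv ?_
    simp only [hqr, eval_mul, eval_X]
    push_cast
    ring

theorem polynomialFourierIntegral_add (hr : RapidlyDecaying g) (hg : MemLp g 2 volume)
    (q r : ℝ[X]) (x : ℝ) : polynomialFourierIntegral g (q + r) x =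
      polynomialFourierIntegral g q x + polynomialFourierIntegral g r x := by
  simp only [polynomialFourierIntegral]
  rw [← integral_add (integrable_exp_mul_eval_mul hr hg q x)
    (integrable_exp_mul_eval_mul hr hg r x)]
  congr 1
  ext ξ
  simp only [eval_add]
  push_cast
  ring

theorem polynomialFourierIntegral_C_mul (a : ℝ) (q : ℝ[X]) (x : ℝ) :
    polynomialFourierIntegral g (C a * q) x = a * polynomialFourierIntegral g q x := by
  simp only [polynomialFourierIntegral]
  rw [← integral_const_mul]
  congr 1
  ext ξ
  simp only [eval_mul, eval_C]
  push_cast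
  ring

end PolynomialFourierIntegral

/-- Phase-twisted transforms of an orthonormal polynomial system satisfy a skew-Hermitian
tridiagonal recurrence. -/
theorem exists_skewHermitianRecurrence {φ : ℕ → ℝ → ℂ} {p : ℕ → ℝ[X]} {α β θ : ℕ → ℝ} {g : ℝ → ℂ}
    (hβ : ∀ n, β n ≠ 0) (h0 : X * p 0 = C (β 0) * p 1 + C (α 0) * p 0)
    (hrec : ∀ n, X * p (n + 1) = C (β (n + 1)) * p (n + 2) + C (α (n + 1)) * p (n + 1)
      + C (β n) * p n)
    (hr : RapidlyDecaying g) (hg : MemLp g 2 volume) {s : ℂ}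
    (hφ : ∀ n x, φ n x =
      Complex.exp (Complex.I * (θ n : ℂ)) / s * polynomialFourierIntegral g (p n) x) :
    ∃ (b : ℕ → ℂ) (c : ℕ → ℝ), (∀ n : ℕ, b n ≠ 0) ∧ SkewHermitianRecurrence φ b c := by
  have hφ' (n : ℕ) (x : ℝ) : HasDerivAt (φ n) (Complex.exp (Complex.I * (θ n : ℂ)) / s *
      (Complex.I * polynomialFourierIntegral g (X * p n) x)) x := by
    rw [funext (hφ n)]
    exact (hasDerivAt_polynomialFourierIntegral hr hg (p n) x).const_mul _
  have hexp (n : ℕ) : Complex.exp (Complex.I * (θ n : ℂ) - Complex.I * (θ (n + 1) : ℂ)) *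
      Complex.exp (Complex.I * (θ (n + 1) : ℂ)) = Complex.exp (Complex.I * (θ n : ℂ)) := by
    rw [← Complex.exp_add, sub_add_cancel]
  have hconj (n : ℕ) : conj (Complex.exp (Complex.I * (θ n : ℂ) - Complex.I * (θ (n + 1) : ℂ))) *
      Complex.exp (Complex.I * (θ n : ℂ)) = Complex.exp (Complex.I * (θ (n + 1) : ℂ)) := by
    rw [← Complex.exp_conj, ← Complex.exp_add]
    simp
  -- The factor i comes from differentiation and the exponential corrects the phase from θ (n + 1)
  -- to θ n; conjugating i produces the minus sign in front of the conjugate coefficient.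
  refine ⟨fun n => Complex.I * β n *
    Complex.exp (Complex.I * (θ n : ℂ) - Complex.I * (θ (n + 1) : ℂ)), α, fun n => ?_,
    fun x => (hφ' 0 x).congr_deriv ?_, fun n x => (hφ' (n + 1) x).congr_deriv ?_⟩
  · exact mul_ne_zero (mul_ne_zero Complex.I_ne_zero (Complex.ofReal_ne_zero.2 (hβ n)))
      (Complex.exp_ne_zero _)
  · rw [h0, polynomialFourierIntegral_add hr hg, polynomialFourierIntegral_C_mul,
      polynomialFourierIntegral_C_mul, hφ, hφ, ← hexp 0]
    ring
  · rw [hrec, polynomialFourierIntegral_add hr hg, polynomialFourierIntegral_add hr hg,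
      polynomialFourierIntegral_C_mul, polynomialFourierIntegral_C_mul,
      polynomialFourierIntegral_C_mul, hφ, hφ, hφ]
    simp only [map_mul, Complex.conj_I, Complex.conj_ofReal]
    linear_combination (-(Complex.I * β n * polynomialFourierIntegral g (p n) x / s)) * hconj n
      - (Complex.I * β (n + 1) * polynomialFourierIntegral g (p (n + 2)) x / s) * hexp (n + 1)

theorem exists_mem_Ico_exp_eq_of_norm_eq_one {u : ℂ} (hu : ‖u‖ = 1) :
    ∃ θ ∈ Set.Ico (0 : ℝ) (2 * Real.pi), Complex.exp (Complex.I * (θ : ℂ)) = u := by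
  have h : Complex.exp (Complex.I * (u.arg : ℂ)) = u := by
    conv_rhs => rw [← Complex.norm_mul_exp_arg_mul_I u, hu]
    rw [Complex.ofReal_one, one_mul, mul_comm]
  rcases lt_or_ge u.arg 0 with h0 | h0
  · refine ⟨u.arg + 2 * Real.pi, ⟨by linarith [Complex.neg_pi_lt_arg u, Real.pi_pos],
      by linarith⟩, ?_⟩
    rw [← h, Complex.exp_eq_exp_iff_exists_int]
    refine ⟨1, ?_⟩
    rw [h]
    push_cast
    ring
  · exact ⟨u.arg, ⟨h0, by linarith [Complex.arg_le_pi u, Real.pi_pos]⟩, h⟩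

theorem MeasureTheory.MemLp.comp_mul_left_real {f : ℝ → ℂ} {q : ENNReal} (hf : MemLp f q volume)
    {a : ℝ} (ha : a ≠ 0) : MemLp (fun x => f (a * x)) q volume := by
  have h : MemLp f q (Measure.map (a * ·) volume) := by
    rw [Real.map_volume_mul_left ha]
    exact hf.smul_measure ENNReal.ofReal_ne_top
  exact h.comp_of_map (by fun_prop)

/-! ### The recurrence in Fourier space: from (i) to (ii). -/

section Fourier

open scoped FourierTransform

/-- The `L²` Fourier transform of a derivative, for an arbitrary `L²` representative. -/
theorem fourier_ae_eq_of_hasDerivAt {f f' : ℝ → ℂ} (hf : MemLp f 2 volume)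
    (hd : ∀ x, HasDerivAt f (f' x) x) {K : Lp ℂ 2 (volume : Measure ℝ)} (hK : K =ᵐ[volume] f') :
    (𝓕 K : Lp ℂ 2 (volume : Measure ℝ)) =ᵐ[volume] fun ξ : ℝ =>
      2 * Real.pi * Complex.I * ξ * (𝓕 (hf.toLp f) : Lp ℂ 2 (volume : Measure ℝ)) ξ := by
  have hf' : MemLp f' 2 volume := (memLp_congr_ae hK).1 (Lp.memLp K)
  have hKL : K = hf'.toLp f' := Lp.ext (hK.trans hf'.coeFn_toLp.symm)
  rw [hKL]
  exact fourier_toLp_deriv hf hf' hd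

/-- Fourier inversion for a continuous square integrable function whose `L²` Fourier transform is
integrable. -/
theorem eq_fourierInv_of_integrable {f : ℝ → ℂ} (hf : MemLp f 2 volume) (hc : Continuous f)
    (hi : Integrable (𝓕 (hf.toLp f) : Lp ℂ 2 (volume : Measure ℝ)) volume) :
    f = 𝓕⁻ ((𝓕 (hf.toLp f) : Lp ℂ 2 (volume : Measure ℝ)) : ℝ → ℂ) := by
  set F : Lp ℂ 2 (volume : Measure ℝ) := 𝓕 (hf.toLp f) with hF
  have h := fourierInv_toLp_ae_eq (Lp.memLp F) hi
  rw [Lp.toLp_coeFn, hF, FourierTransform.fourierInv_fourier_eq] at h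
  have hcont : Continuous (𝓕⁻ (F : ℝ → ℂ)) :=
    VectorFourier.fourierIntegral_continuous Real.continuous_fourierChar
      (by simp only [LinearMap.neg_apply, innerₗ_apply_apply]; fun_prop) hi
  exact (hc.ae_eq_iff_eq volume hcont).1 (hf.coeFn_toLp.symm.trans h)

end Fourier

/-- The unimodular factors relating a skew-Hermitian recurrence to a real symmetric one. -/
noncomputable def recurrencePhase (b : ℕ → ℂ) : ℕ → ℂ
  | 0 => 1
  | n + 1 => Complex.I * recurrencePhase b n * (‖b n‖ / b n)

section RecurrencePhase

variable {b : ℕ → ℂ}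

theorem norm_recurrencePhase (hb : ∀ n, b n ≠ 0) (n : ℕ) : ‖recurrencePhase b n‖ = 1 := by
  induction n with
  | zero => simp [recurrencePhase]
  | succ n ih =>
    simp [recurrencePhase, ih, div_self (norm_ne_zero_iff.2 (hb n))]

/-- With `conj_mul_recurrencePhase`, this gives both off-diagonal terms of the transformed
recurrence the same factor i uₙ as the other terms; cancelling it leaves the real symmetric
recurrence. -/
theorem mul_recurrencePhase_succ (hb : ∀ n, b n ≠ 0) (n : ℕ) :
    b n * recurrencePhase b (n + 1) = Complex.I * ‖b n‖ * recurrencePhase b n := by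
  rw [recurrencePhase]
  field_simp [hb n]

theorem conj_mul_recurrencePhase (hb : ∀ n, b n ≠ 0) (n : ℕ) :
    conj (b n) * recurrencePhase b n = -Complex.I * ‖b n‖ * recurrencePhase b (n + 1) := by
  have h : (‖b n‖ : ℂ) * ‖b n‖ = conj (b n) * b n := by
    rw [← Complex.normSq_eq_conj_mul_self, Complex.normSq_eq_norm_sq]
    push_cast
    ring
  apply mul_left_cancel₀ (hb n)
  linear_combination (Complex.I * ‖b n‖) * mul_recurrencePhase_succ hb n
    - recurrencePhase b n * h + (‖b n‖ : ℂ) * ‖b n‖ * recurrencePhase b n * Complex.I_mul_I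

end RecurrencePhase

section Recurrence

open scoped FourierTransform

variable {φ : ℕ → ℝ → ℂ} {b : ℕ → ℂ} {c : ℕ → ℝ}

theorem SkewHermitianRecurrence.exists_hasDerivAt_memLp (h : SkewHermitianRecurrence φ b c)
    (hφ : ∀ n : ℕ, MemLp (φ n) 2 volume) (n : ℕ) :
    ∃ f' : ℝ → ℂ, MemLp f' 2 volume ∧ ∀ x, HasDerivAt (φ n) (f' x) x := by
  cases n with
  | zero => exact ⟨_, ((hφ 0).const_mul _).add ((hφ 1).const_mul _), h.1⟩
  | succ n =>
    exact ⟨_, (((hφ n).const_mul _).add ((hφ (n + 1)).const_mul _)).add ((hφ (n + 2)).const_mul _),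
      h.2 n⟩

/-- The Fourier transforms of the solutions of a skew-Hermitian recurrence. -/
theorem SkewHermitianRecurrence.fourier_ae_eq (h : SkewHermitianRecurrence φ b c)
    (hb : ∀ n, b n ≠ 0) (hφ : ∀ n : ℕ, MemLp (φ n) 2 volume) (n : ℕ) :
    (𝓕 ((hφ n).toLp (φ n)) : Lp ℂ 2 (volume : Measure ℝ)) =ᵐ[volume] fun ξ : ℝ =>
      recurrencePhase b n *
        (((jacobiPolynomial (fun k => ‖b k‖) c n).eval (2 * Real.pi * ξ) : ℝ) : ℂ) *
        (𝓕 ((hφ 0).toLp (φ 0)) : Lp ℂ 2 (volume : Measure ℝ)) ξ := by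
  have hβ (k : ℕ) : ‖b k‖ ≠ 0 := norm_ne_zero_iff.2 (hb k)
  obtain ⟨E, hE⟩ : ∃ E : ℕ → Lp ℂ 2 (volume : Measure ℝ), ∀ k, E k = 𝓕 ((hφ k).toLp (φ k)) :=
    ⟨_, fun _ => rfl⟩
  obtain ⟨P, hP⟩ : ∃ P : ℕ → ℝ[X], P = jacobiPolynomial (fun k => ‖b k‖) c := ⟨_, rfl⟩
  simp only [← hE, ← hP]
  have h0 : ∀ᵐ ξ : ℝ, 2 * Real.pi * Complex.I * ξ * E 0 ξ =
      Complex.I * c 0 * E 0 ξ + b 0 * E 1 ξ := by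
    -- The right-hand side is assembled inside L², where the Fourier transform is linear.
    set K : Lp ℂ 2 (volume : Measure ℝ) :=
      (Complex.I * c 0) • (hφ 0).toLp (φ 0) + b 0 • (hφ 1).toLp (φ 1) with hK
    have hKf : K =ᵐ[volume] fun x => Complex.I * (c 0 : ℂ) * φ 0 x + b 0 * φ 1 x := by
      filter_upwards [Lp.coeFn_add ((Complex.I * c 0 : ℂ) • (hφ 0).toLp (φ 0))
        (b 0 • (hφ 1).toLp (φ 1)), Lp.coeFn_smul (Complex.I * c 0 : ℂ) ((hφ 0).toLp (φ 0)),
        Lp.coeFn_smul (b 0) ((hφ 1).toLp (φ 1)), (hφ 0).coeFn_toLp, (hφ 1).coeFn_toLp]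
        with x h1 h2 h3 h4 h5
      rw [hK, h1, Pi.add_apply, h2, h3, Pi.smul_apply, Pi.smul_apply, h4, h5, smul_eq_mul,
        smul_eq_mul]
    have hF := fourier_ae_eq_of_hasDerivAt (hφ 0) h.1 hKf
    rw [hK, FourierTransform.fourier_add, FourierTransform.fourier_smul,
      FourierTransform.fourier_smul, ← hE, ← hE] at hF
    filter_upwards [hF, Lp.coeFn_add ((Complex.I * c 0 : ℂ) • E 0) (b 0 • E 1),
      Lp.coeFn_smul (Complex.I * c 0 : ℂ) (E 0), Lp.coeFn_smul (b 0) (E 1)] with x h1 h2 h3 h4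
    rw [← h1, h2, Pi.add_apply, h3, h4, Pi.smul_apply, Pi.smul_apply, smul_eq_mul, smul_eq_mul]
  have hrec (k : ℕ) : ∀ᵐ ξ : ℝ, 2 * Real.pi * Complex.I * ξ * E (k + 1) ξ =
      -conj (b k) * E k ξ + Complex.I * c (k + 1) * E (k + 1) ξ + b (k + 1) * E (k + 2) ξ := by
    set A : Lp ℂ 2 (volume : Measure ℝ) := (hφ k).toLp (φ k) with hA
    set B : Lp ℂ 2 (volume : Measure ℝ) := (hφ (k + 1)).toLp (φ (k + 1)) with hB
    set D : Lp ℂ 2 (volume : Measure ℝ) := (hφ (k + 2)).toLp (φ (k + 2)) with hD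
    set K : Lp ℂ 2 (volume : Measure ℝ) :=
      (-conj (b k)) • A + (Complex.I * c (k + 1)) • B + b (k + 1) • D with hK
    have hcoe (A B D : Lp ℂ 2 (volume : Measure ℝ)) (r s t : ℂ) :
        (r • A + s • B + t • D : Lp ℂ 2 (volume : Measure ℝ)) =ᵐ[volume]
          fun x => r * A x + s * B x + t * D x := by
      filter_upwards [Lp.coeFn_add (r • A + s • B) (t • D), Lp.coeFn_add (r • A) (s • B),
        Lp.coeFn_smul r A, Lp.coeFn_smul s B, Lp.coeFn_smul t D] with x h1 h2 h3 h4 h5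
      rw [h1, Pi.add_apply, h2, Pi.add_apply, h3, h4, h5]
      rfl
    have hKf : K =ᵐ[volume] fun x => -conj (b k) * φ k x
        + Complex.I * (c (k + 1) : ℂ) * φ (k + 1) x + b (k + 1) * φ (k + 2) x := by
      filter_upwards [hcoe A B D (-conj (b k)) (Complex.I * c (k + 1)) (b (k + 1)),
        (hφ k).coeFn_toLp, (hφ (k + 1)).coeFn_toLp, (hφ (k + 2)).coeFn_toLp] with x h1 h2 h3 h4
      rw [hK, h1, hA, hB, hD, h2, h3, h4]
    have hF := fourier_ae_eq_of_hasDerivAt (hφ (k + 1)) (h.2 k) hKf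
    rw [hK, FourierTransform.fourier_add, FourierTransform.fourier_add,
      FourierTransform.fourier_smul, FourierTransform.fourier_smul,
      FourierTransform.fourier_smul, hA, hB, hD, ← hE, ← hE, ← hE] at hF
    filter_upwards [hF, hcoe (E k) (E (k + 1)) (E (k + 2)) (-conj (b k))
      (Complex.I * c (k + 1)) (b (k + 1))] with x h1 h2
    rw [← h1, h2]
  induction n using Nat.twoStepInduction with
  | zero => simp [hP, recurrencePhase, jacobiPolynomial_zero]
  | one =>
    filter_upwards [h0] with ξ hξ
    have h1 := congrArg (fun t : ℝ => (t : ℂ))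
      (mul_eval_jacobiPolynomial_one (c := c) hβ (2 * Real.pi * ξ))
    have h2 := mul_recurrencePhase_succ hb 0
    simp only [jacobiPolynomial_zero, eval_one, ← hP] at h1
    push_cast at h1
    rw [show recurrencePhase b 0 = 1 from rfl] at h2
    apply mul_left_cancel₀ (hb 0)
    linear_combination -hξ - ((P 1).eval (2 * Real.pi * ξ) : ℝ) * E 0 ξ * h2
      - Complex.I * E 0 ξ * h1
  | more n ih1 ih2 =>
    filter_upwards [hrec n, ih1, ih2] with ξ hξ h1 h2
    have h3 := congrArg (fun t : ℝ => (t : ℂ))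
      (mul_eval_jacobiPolynomial_add_two (c := c) hβ n (2 * Real.pi * ξ))
    simp only [← hP] at h3
    push_cast at h3
    have h4 := mul_recurrencePhase_succ hb (n + 1)
    have h5 := conj_mul_recurrencePhase hb n
    rw [h1, h2] at hξ
    apply mul_left_cancel₀ (hb (n + 1))
    linear_combination -hξ
      - ((P (n + 2)).eval (2 * Real.pi * ξ) : ℝ) * E 0 ξ * h4
      - Complex.I * recurrencePhase b (n + 1) * E 0 ξ * h3
      + ((P n).eval (2 * Real.pi * ξ) : ℝ) * E 0 ξ * h5

/-- The recurrence puts φₙ' in L², so the transform of φₙ and its product with ξ are in L²; the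
transform is therefore integrable. Continuity of φₙ upgrades inversion from almost everywhere to
every point. -/
theorem SkewHermitianRecurrence.eq_fourierInv (h : SkewHermitianRecurrence φ b c)
    (hφ : ∀ n : ℕ, MemLp (φ n) 2 volume) (n : ℕ) :
    φ n = 𝓕⁻ ((𝓕 ((hφ n).toLp (φ n)) : Lp ℂ 2 (volume : Measure ℝ)) : ℝ → ℂ) := by
  obtain ⟨f', hf', hd⟩ := h.exists_hasDerivAt_memLp hφ n
  refine eq_fourierInv_of_integrable (hφ n)
    (continuous_iff_continuousAt.2 fun x => (hd x).continuousAt) ?_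
  refine integrable_of_memLp_two_of_memLp_two_mul (Lp.memLp _) ?_
  refine ((Lp.memLp (𝓕 (hf'.toLp f') : Lp ℂ 2 (volume : Measure ℝ))).const_mul
    (2 * Real.pi * Complex.I)⁻¹).ae_eq ?_
  filter_upwards [fourier_toLp_deriv (hφ n) hf' hd] with ξ hξ
  rw [hξ]
  have hpi : (Real.pi : ℂ) ≠ 0 := Complex.ofReal_ne_zero.2 Real.pi_ne_zero
  field_simp [Complex.I_ne_zero]

end Recurrence

/-! ### The generating function g and the integral representation. -/

section Representation

open scoped FourierTransform

/-- If the products of `G` with all members of a full polynomial sequence are square integrable,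
then so are its products with all powers. -/
theorem rapidlyDecaying_of_forall_memLp_eval_mul {p : ℕ → ℝ[X]} (hp : ∀ n : ℕ, (p n).degree = n)
    {g : ℝ → ℂ} (hg : MemLp g 2 volume)
    (h : ∀ n, MemLp (fun ξ : ℝ => (((p n).eval ξ : ℝ) : ℂ) * g ξ) 2 volume) :
    RapidlyDecaying g := by
  rw [rapidlyDecaying_iff_forall_memLp hg]
  intro n
  obtain ⟨a, ha⟩ := exists_eq_sum_of_degree_eq hp n (X ^ n) (natDegree_X_pow_le n)
  have hsum (ξ : ℝ) : (ξ : ℂ) ^ n * g ξ = ∑ k ∈ Finset.range (n + 1),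
      (a k : ℂ) * ((((p k).eval ξ : ℝ) : ℂ) * g ξ) := by
    have h1 := congrArg (fun q : ℝ[X] => ((q.eval ξ : ℝ) : ℂ)) ha
    simp only [eval_pow, eval_X, eval_finsetSum, eval_mul, eval_C] at h1
    push_cast at h1
    rw [h1, Finset.sum_mul]
    simp only [mul_assoc]
  simp only [hsum]
  exact memLp_finsetSum _ fun k _ => (h k).const_mul _

/-- Rescaling of the inverse Fourier integral to the unitary angular-frequency convention. -/
theorem fourierInv_eq_integral_exp_I (F : ℝ → ℂ) (x : ℝ) :
    𝓕⁻ F x = (1 / (Real.sqrt (2 * Real.pi) : ℂ)) *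
      ∫ ξ : ℝ, Complex.exp (Complex.I * (x : ℂ) * (ξ : ℂ)) *
        ((Real.sqrt (2 * Real.pi) : ℂ)⁻¹ * F ((2 * Real.pi)⁻¹ * ξ)) := by
  have hpi : (0 : ℝ) < 2 * Real.pi := by positivity
  have hs : (Real.sqrt (2 * Real.pi) : ℂ) * Real.sqrt (2 * Real.pi) = (2 * Real.pi : ℝ) := by
    rw [← Complex.ofReal_mul, Real.mul_self_sqrt hpi.le]
  have hs0 : (Real.sqrt (2 * Real.pi) : ℂ) ≠ 0 :=
    Complex.ofReal_ne_zero.2 (Real.sqrt_pos.2 hpi).ne'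
  -- Substituting v = ξ / (2π) produces a factor 1 / (2π): one 1 / √(2π) stays in front, the other
  -- goes into g.
  have hchange := Measure.integral_comp_mul_left
    (fun v : ℝ => Complex.exp (((2 * Real.pi * (v * x) : ℝ) : ℂ) * Complex.I) * F v)
    (2 * Real.pi)⁻¹
  rw [inv_inv, abs_of_pos hpi] at hchange
  have hint (ξ : ℝ) : Complex.exp (Complex.I * (x : ℂ) * (ξ : ℂ)) *
      ((Real.sqrt (2 * Real.pi) : ℂ)⁻¹ * F ((2 * Real.pi)⁻¹ * ξ)) =
      (Real.sqrt (2 * Real.pi) : ℂ)⁻¹ *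
        (Complex.exp (((2 * Real.pi * ((2 * Real.pi)⁻¹ * ξ * x) : ℝ) : ℂ) * Complex.I) *
          F ((2 * Real.pi)⁻¹ * ξ)) := by
    rw [show 2 * Real.pi * ((2 * Real.pi)⁻¹ * ξ * x) = x * ξ by field_simp,
      show ((x * ξ : ℝ) : ℂ) * Complex.I = Complex.I * x * ξ by push_cast; ring]
    ring
  simp only [hint]
  rw [integral_const_mul, hchange, Real.fourierInv_eq', Complex.real_smul, ← hs]
  have hinner (v : ℝ) : inner ℝ v x = v * x := by simp [mul_comm]
  simp only [hinner, smul_eq_mul]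
  generalize ∫ v : ℝ, Complex.exp (((2 * Real.pi * (v * x) : ℝ) : ℂ) * Complex.I) * F v = J
  field_simp

theorem SkewHermitianRecurrence.exists_representation {φ : ℕ → ℝ → ℂ} {b : ℕ → ℂ} {c : ℕ → ℝ}
    (h : SkewHermitianRecurrence φ b c) (hb : ∀ n, b n ≠ 0)
    (hφ : ∀ n : ℕ, MemLp (φ n) 2 volume) :
    ∃ g : ℝ → ℂ, MemLp g 2 volume ∧ RapidlyDecaying g ∧ ∀ (n : ℕ) (x : ℝ),
      φ n x = recurrencePhase b n / (Real.sqrt (2 * Real.pi) : ℂ) *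
        polynomialFourierIntegral g (jacobiPolynomial (fun k => ‖b k‖) c n) x := by
  have hβ (k : ℕ) : ‖b k‖ ≠ 0 := norm_ne_zero_iff.2 (hb k)
  have hpi : 2 * Real.pi ≠ 0 := by positivity
  set P := jacobiPolynomial (fun k => ‖b k‖) c with hP
  set G : Lp ℂ 2 (volume : Measure ℝ) := 𝓕 ((hφ 0).toLp (φ 0)) with hG
  set s : ℂ := (Real.sqrt (2 * Real.pi) : ℂ) with hs
  have hae := h.fourier_ae_eq hb hφ
  rw [← hP, ← hG] at hae
  have hu (n : ℕ) : recurrencePhase b n ≠ 0 :=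
    norm_ne_zero_iff.1 (by rw [norm_recurrencePhase hb]; exact one_ne_zero)
  have hscale (ξ : ℝ) : 2 * Real.pi * ((2 * Real.pi)⁻¹ * ξ) = ξ := mul_inv_cancel_left₀ hpi ξ
  have hg : MemLp (fun ξ : ℝ => s⁻¹ * G ((2 * Real.pi)⁻¹ * ξ)) 2 volume :=
    ((Lp.memLp G).comp_mul_left_real (inv_ne_zero hpi)).const_mul _
  refine ⟨fun ξ => s⁻¹ * G ((2 * Real.pi)⁻¹ * ξ), hg,
    rapidlyDecaying_of_forall_memLp_eval_mul (degree_jacobiPolynomial (c := c) hβ) hg fun n => ?_,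
    fun n x => ?_⟩
  · have h1 : MemLp (fun ξ : ℝ => (((P n).eval (2 * Real.pi * ξ) : ℝ) : ℂ) * G ξ) 2 volume := by
      refine ((Lp.memLp (𝓕 ((hφ n).toLp (φ n)) : Lp ℂ 2 (volume : Measure ℝ))).const_mul
        (recurrencePhase b n)⁻¹).ae_eq ?_
      filter_upwards [hae n] with ξ hξ
      rw [hξ, mul_assoc, inv_mul_cancel_left₀ (hu n)]
    refine ((h1.comp_mul_left_real (inv_ne_zero hpi)).const_mul s⁻¹).ae_eq
      (ae_of_all _ fun ξ => ?_)
    simp only [hscale]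
    ring
  · rw [h.eq_fourierInv hφ n, Real.fourierInv_congr_ae (hae n), fourierInv_eq_integral_exp_I,
      polynomialFourierIntegral, ← integral_const_mul, ← integral_const_mul]
    congr 1
    ext ξ
    rw [hscale]
    ring

end Representation

theorem theorem1 (φ : ℕ → ℝ → ℂ) (hφ : ∀ n : ℕ, MemLp (φ n) 2 volume) :
    (∃ (b : ℕ → ℂ) (c : ℕ → ℝ), (∀ n : ℕ, b n ≠ 0) ∧ SkewHermitianRecurrence φ b c) ↔
    ∃ (μ : Measure ℝ) (p : ℕ → ℝ[X]) (g : ℝ → ℂ) (θ : ℕ → ℝ),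
      IsProbabilityMeasure μ ∧
      HasFiniteMoments μ ∧
      μ.support.Infinite ∧
      IsOrthonormalPolynomialSystem p μ ∧
      MemLp g 2 volume ∧
      RapidlyDecaying g ∧
      (∀ n : ℕ, θ n ∈ Set.Ico 0 (2 * Real.pi)) ∧
      ∀ (n : ℕ) (x : ℝ),
        φ n x = Complex.exp (Complex.I * (θ n : ℂ)) / (Real.sqrt (2 * Real.pi) : ℂ) *
          ∫ ξ : ℝ, Complex.exp (Complex.I * (x : ℂ) * (ξ : ℂ)) * (((p n).eval ξ : ℝ) : ℂ) * g ξ := by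
  constructor
  · rintro ⟨b, c, hb, h⟩
    obtain ⟨μ, hμp, hμ, hμo⟩ :=
      exists_orthogonality_measure (c := c) fun k => norm_ne_zero_iff.2 (hb k)
    obtain ⟨g, hg, hgr, hgφ⟩ := h.exists_representation hb hφ
    choose θ hθ hθu using fun n =>
      exists_mem_Ico_exp_eq_of_norm_eq_one (norm_recurrencePhase hb n)
    refine ⟨μ, _, g, θ, hμp, hμ, hμo.infinite_support hμ, hμo, hg, hgr, hθ, fun n x => ?_⟩
    rw [hθu]
    exact hgφ n x
  · rintro ⟨μ, p, g, θ, -, hμ, -, hp, hg, hgr, -, hgφ⟩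
    obtain ⟨α, β, hβ, h0, hrec⟩ := hp.exists_three_term hμ
    exact exists_skewHermitianRecurrence hβ h0 hrec hgr hg hgφ
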